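/- \textbf{Setting.} Consider a tabular episodic MDP with finite state space $\mathcal S$, finite action space $\mathcal A$, horizon $H$, initial state distribution $\rho$, transition functions $P_1,\dots,P_H$ and rewards $r_h:\mathcal S\times\mathcal A\to[0,1]$. For a (stochastic, non-stationary) policy $\pi$ let $\mathbb P^\pi$ be the law of the trajectory $(s_1,a_1,\dots,s_H,a_H)$ under $\pi$, $P^\pi_h(s,a)=\mathbb P^\pi(s_h=s,a_h=a)$, and $V^\pi=\mathbb E^\pi\big[\sum_{h=1}^H r_h(s_h,a_h)\big]$. Let $\pi^{\rm E}$ be a deterministic expert policy and $\mathcal D$ a dataset of $m$ independent trajectories of $\pi^{\rm E}$. The functions $\rho, P_1,\dots,P_H$ are known to the learner. \textbf{Algorithm (TAIL).} Inputs: $\mathcal D$, number of iterations $T$, step sizes $\eta^{(t)}$, and an initialization $w^{(1)}\in\mathcal W:=\{w=(w_h(s,a)):\|w\|_\infty\le 1\}$. 1. Split $\mathcal D$ uniformly at random into two equal parts $\mathcal D_1$ and $\mathcal D_1^c$ (of sizes $\lfloor m/2\rfloor$ and $\lceil m/2\rceil$). Let $\mathbf{Tr}_h^{\mathcal D_1}$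 be the set of truncated trajectories $\mathrm{tr}_h=(s_1,a_1,\dots,s_h,a_h)$ such that, for each $\ell\le h$, the state $s_\ell$ is visited at time step $\ell$ by some trajectory in $\mathcal D_1$. Form the estimator $$\widetilde P_h(s,a)=\sum_{\mathrm{tr}_h\in\mathbf{Tr}_h^{\mathcal D_1}}\mathbb P^{\pi^{\rm E}}(\mathrm{tr}_h)\,\mathbb I\{(s_h,a_h)=(s,a)\}+\frac{1}{|\mathcal D_1^c|}\sum_{\mathrm{tr}\in\mathcal D_1^c}\mathbb I\{(s_h,a_h)=(s,a),\ \mathrm{tr}_h\notin\mathbf{Tr}_h^{\mathcal D_1}\}.$$ 2. For $t=1,\dots,T$: let $\pi^{(t)}$ be any policy that is optimal for the reward function $w^{(t)}$ up to an error of $\varepsilon_{\rm opt}$; set $f^{(t)}(w)=\sum_{h}\sum_{s,a} w_h(s,a)\big(P_h^{\pi^{(t)}}(s,a)-\widetilde P_h(s,a)\big)$ and $w^{(t+1)}=\mathcal P_{\mathcal W}\big(w^{(t)}-\eta^{(t)}\nabla f^{(t)}(w^{(t)})\big)$, where $\mathcal P_{\mathcal W}$ is the Euclidean projection on $\mathcal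 W$. 3. Let $\overline P_h(s,a)=\frac1T\sum_{t=1}^T P_h^{\pi^{(t)}}(s,a)$ and output a policy $\overline\pi$ with $\overline\pi_h(a|s)=\overline P_h(s,a)/\sum_{a'}\overline P_h(s,a')$ whenever the denominator is positive ($\overline\pi_h(\cdot|s)$ is arbitrary otherwise). \textbf{Theorem.} There are absolute constants $C_1,C_2>0$ such that the following holds for every such MDP and deterministic expert policy. Let $H\ge5$, $\varepsilon\in(0,H)$, $\delta\in(0,1)$, $\varepsilon_{\rm opt}\le\varepsilon/2$, $w^{(1)}\in\mathcal W$, $$T\ \ge\ C_1\,\frac{|\mathcal S||\mathcal A|H^2}{\varepsilon^2},\qquad \eta^{(t)}=\sqrt{\frac{|\mathcal S||\mathcal A|}{8T}}\ \ (1\le t\le T),\qquad m\ \ge\ C_2\,\frac{|\mathcal S|H^{3/2}}{\varepsilon}\log\Big(\frac{|\mathcal S|H}{\delta}\Big).$$ Then, with probability at least $1-\delta$ over the dataset and the random split, every output $\overline\pi$ of TAIL satisfies $V^{\pi^{\rm E}}-V^{\overline\pi}\le\varepsilon$. -/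

import Mathlib

open scoped ENNReal Gradient

/-- A tabular episodic MDP with horizon `H`. Time step `h` of the usual numbering `1, …, H` is
`h - 1 : Fin H`. `ρ` is the initial state distribution, `P h s a` the distribution of the state at
the step after `h`, and `r` the reward with values in `[0, 1]`. -/
structure EpisodicMDP (S A : Type*) [Fintype S] [Fintype A] (H : ℕ) where
  ρ : stdSimplex ℝ S
  P : Fin H → S → A → stdSimplex ℝ S
  r : Fin H → S → A → ℝ
  r_nonneg : ∀ h s a, 0 ≤ r h s a
  r_le_one : ∀ h s a, r h s a ≤ 1

/-- Non-stationary stochastic policies: `π h s a` is the probability of action `a` in state `s` at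
time step `h`. -/
abbrev Policy (S A : Type*) [Fintype A] (H : ℕ) := Fin H → S → stdSimplex ℝ A

open scoped Classical in
/-- The stochastic policy that plays the deterministic policy `μ`. -/
noncomputable def Policy.ofDet {S A : Type*} [Fintype A] {H : ℕ} (μ : Fin H → S → A) :
    Policy S A H :=
  fun h s => stdSimplex.vertex (μ h s)

/-- Trajectories truncated to their first `n` time steps; `Traj S A H` is the full ones. -/
abbrev Traj (S A : Type*) (n : ℕ) := Fin n → S × A

/-- The first `n` steps of a full trajectory. -/
def Traj.trunc {S A : Type*} {H n : ℕ} (hn : n ≤ H) (τ : Traj S A H) : Traj S A n :=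
  fun l => τ (Fin.castLE hn l)

namespace EpisodicMDP

variable {S A : Type*} [Fintype S] [Fintype A] {H : ℕ}

/-- The probability of the state at position `l` of `τ`, given the previous state-action pair. -/
noncomputable def stateProb (M : EpisodicMDP S A H) {n : ℕ} (hn : n ≤ H) (τ : Traj S A n)
    (l : Fin n) : ℝ :=
  if 0 < l.1 then
    M.P ⟨l.1 - 1, by omega⟩ (τ ⟨l.1 - 1, by omega⟩).1 (τ ⟨l.1 - 1, by omega⟩).2 (τ l).1
  else M.ρ (τ l).1

/-- `ℙ^π(tr_n)`: the probability that the first `n` steps of an episode under `π` are `τ`. -/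
noncomputable def trajProb (M : EpisodicMDP S A H) (π : Policy S A H) {n : ℕ} (hn : n ≤ H)
    (τ : Traj S A n) : ℝ :=
  ∏ l : Fin n, M.stateProb hn τ l * π (Fin.castLE hn l) (τ l).1 (τ l).2

lemma stateProb_nonneg (M : EpisodicMDP S A H) {n : ℕ} (hn : n ≤ H) (τ : Traj S A n)
    (l : Fin n) : 0 ≤ M.stateProb hn τ l := by
  unfold stateProb
  split
  · exact stdSimplex.zero_le _ _
  · exact stdSimplex.zero_le _ _

lemma trajProb_nonneg (M : EpisodicMDP S A H) (π : Policy S A H) {n : ℕ} (hn : n ≤ H)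
    (τ : Traj S A n) : 0 ≤ M.trajProb π hn τ :=
  Finset.prod_nonneg fun l _ => mul_nonneg (M.stateProb_nonneg hn τ l) (stdSimplex.zero_le _ _)

lemma sum_trajProb (M : EpisodicMDP S A H) (π : Policy S A H) {n : ℕ} (hn : n ≤ H) :
    ∑ τ : Traj S A n, M.trajProb π hn τ = 1 := by
  induction n with
  | zero => simp [trajProb]
  | succ n ih =>
    have hn' : n ≤ H := by omega
    rw [← (Fin.snocEquiv (fun _ : Fin (n + 1) => S × A)).sum_comp, Fintype.sum_prod_type,
      Finset.sum_comm, ← ih hn']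
    refine Finset.sum_congr rfl fun τ _ => ?_
    have key : ∀ x : S × A, M.trajProb π hn (Fin.snocEquiv (fun _ : Fin (n + 1) => S × A) (x, τ))
        = M.trajProb π hn' τ * (M.stateProb hn (Fin.snoc (α := fun _ => S × A) τ x) (Fin.last n)
          * π (Fin.castLE hn (Fin.last n)) x.1 x.2) := by
      intro x
      have h1 : ∀ l : Fin n, M.stateProb hn (Fin.snoc (α := fun _ => S × A) τ x) l.castSucc
          = M.stateProb hn' τ l := by
        intro l
        have h2 : (Fin.snoc (α := fun _ => S × A) τ x : Fin (n + 1) → S × A)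
            ⟨l.1 - 1, by omega⟩ = τ ⟨l.1 - 1, by omega⟩ :=
          Fin.snoc_castSucc (α := fun _ => S × A) x τ ⟨l.1 - 1, by omega⟩
        simp only [stateProb, Fin.val_castSucc, h2, Fin.snoc_castSucc]
      have h0 : Fin.snocEquiv (fun _ : Fin (n + 1) => S × A) (x, τ)
          = Fin.snoc (α := fun _ => S × A) τ x := rfl
      rw [h0]
      simp only [trajProb]
      rw [Fin.prod_univ_castSucc]
      simp only [h1, Fin.snoc_castSucc, Fin.snoc_last]
      rfl
    simp only [key]
    rw [← Finset.mul_sum, Fintype.sum_prod_type]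
    have h3 : ∀ s : S, ∑ a : A, M.stateProb hn (Fin.snoc (α := fun _ => S × A) τ (s, a))
          (Fin.last n) * π (Fin.castLE hn (Fin.last n)) s a
        = if h : 0 < n then
            M.P ⟨n - 1, by omega⟩ (τ ⟨n - 1, by omega⟩).1 (τ ⟨n - 1, by omega⟩).2 s
          else M.ρ s := by
      intro s
      have h4 : ∀ a : A, M.stateProb hn (Fin.snoc (α := fun _ => S × A) τ (s, a)) (Fin.last n)
          = if h : 0 < n then
              M.P ⟨n - 1, by omega⟩ (τ ⟨n - 1, by omega⟩).1 (τ ⟨n - 1, by omega⟩).2 s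
            else M.ρ s := by
        intro a
        unfold stateProb
        by_cases h : 0 < n
        · have h2 : (Fin.snoc (α := fun _ => S × A) τ (s, a) : Fin (n + 1) → S × A)
              ⟨n - 1, by omega⟩ = τ ⟨n - 1, by omega⟩ :=
            Fin.snoc_castSucc (α := fun _ => S × A) (s, a) τ ⟨n - 1, by omega⟩
          simp only [Fin.val_last, h, if_true, dif_pos, h2, Fin.snoc_last]
        · simp only [Fin.val_last, h, if_false, dif_neg, not_false_eq_true, Fin.snoc_last]
      simp only [h4]
      rw [← Finset.mul_sum, stdSimplex.sum_eq_one, mul_one]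
    simp only [h3]
    by_cases h : 0 < n <;> simp [h, stdSimplex.sum_eq_one]

/-- The law of a full trajectory when the policy `π` is rolled out. -/
noncomputable def trajLaw (M : EpisodicMDP S A H) (π : Policy S A H) : PMF (Traj S A H) :=
  PMF.ofFintype (fun τ => ENNReal.ofReal (M.trajProb π le_rfl τ)) (by
    rw [← ENNReal.ofReal_sum_of_nonneg fun τ _ => M.trajProb_nonneg π le_rfl τ,
      M.sum_trajProb π le_rfl, ENNReal.ofReal_one])

/-- The law of a dataset of `m` independent trajectories generated by `π`. -/
noncomputable def dataLaw (M : EpisodicMDP S A H) (π : Policy S A H) (m : ℕ) :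
    PMF (Fin m → Traj S A H) :=
  PMF.ofFintype (fun D => ∏ i, M.trajLaw π (D i)) (by
    classical
    have h : ∑ τ, M.trajLaw π τ = 1 := by
      rw [← tsum_fintype (L := .unconditional _)]; exact (M.trajLaw π).tsum_coe
    rw [← Fintype.piFinset_univ, ← Finset.prod_univ_sum]
    simp [h])

open scoped Classical in
/-- The state-action distribution `P_h^π(s, a)`: the probability that the pair visited at time
step `h` under `π` is `(s, a)`. -/
noncomputable def occ (M : EpisodicMDP S A H) (π : Policy S A H) (h : Fin H) (s : S) (a : A) : ℝ :=
  ∑ τ : Traj S A H, if τ h = (s, a) then M.trajProb π le_rfl τ else 0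

/-- The value of the policy `π` for the reward function `w`: its expected long-term return. -/
noncomputable def valueOf (M : EpisodicMDP S A H) (w : Fin H → S → A → ℝ) (π : Policy S A H) : ℝ :=
  ∑ τ : Traj S A H, M.trajProb π le_rfl τ * ∑ h, w h (τ h).1 (τ h).2

/-- The policy value `V^π`. -/
noncomputable def value (M : EpisodicMDP S A H) (π : Policy S A H) : ℝ := M.valueOf M.r π

end EpisodicMDP

/-- The uniform law on the ways to split `m` trajectories into a first part of size `⌊m/2⌋` (the
indices in the random set) and its complement: two equal parts if `m` is even. -/
noncomputable def splitLaw (m : ℕ) : PMF (Finset (Fin m)) :=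
  PMF.uniformOfFinset (Finset.powersetCard (m / 2) Finset.univ)
    (Finset.powersetCard_nonempty.2 (by simpa using Nat.div_le_self m 2))

namespace TAIL

variable {S A : Type*} {H : ℕ}

/-- `Tr_n^{D₁}`: the truncated trajectories of length `n` all of whose states have been visited at
the same time step in `D₁`, the trajectories of `D` with index in `I`. -/
def coveredTraj {m : ℕ} (D : Fin m → Traj S A H) (I : Finset (Fin m)) {n : ℕ} (hn : n ≤ H) :
    Set (Traj S A n) :=
  {τ | ∀ l : Fin n, ∃ i ∈ I, (D i (Fin.castLE hn l)).1 = (τ l).1}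

/-- Reward functions `w = (w_h(s, a))`, with the Euclidean norm. -/
abbrev Reward (S A : Type*) (H : ℕ) := EuclideanSpace ℝ (Fin H × S × A)

/-- The set `W` of reward functions with `‖w‖_∞ ≤ 1`. -/
def rewardBall (S A : Type*) (H : ℕ) : Set (Reward S A H) := {w | ∀ x, |w x| ≤ 1}

/-- `z` is the Euclidean projection of `x` on `K`. -/
def IsProj {E : Type*} [NormedAddCommGroup E] (K : Set E) (x z : E) : Prop :=
  z ∈ K ∧ ∀ y ∈ K, ‖z - x‖ ≤ ‖y - x‖

variable [Fintype S] [Fintype A]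

open scoped Classical in
/-- The transition-aware estimator of the expert's state-action distribution, built from the
first part `I` and the second part `Iᶜ` of the dataset `D`. -/
noncomputable def estimator (M : EpisodicMDP S A H) (πE : Fin H → S → A) {m : ℕ}
    (D : Fin m → Traj S A H) (I : Finset (Fin m)) (h : Fin H) (s : S) (a : A) : ℝ :=
  (∑ τ : Traj S A (h.1 + 1),
    if τ ∈ coveredTraj D I h.2 ∧ τ (Fin.last h.1) = (s, a) then
      M.trajProb (Policy.ofDet πE) h.2 τ else 0)
  + (∑ i ∈ Iᶜ, if D i h = (s, a) ∧ (D i).trunc h.2 ∉ coveredTraj D I h.2 then (1 : ℝ) else 0)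
      / (Iᶜ.card : ℝ)

/-- The objective `f(w) = ∑_h ∑_{s, a} w_h(s, a) (P_h^π(s, a) - q_h(s, a))`. -/
noncomputable def objective (M : EpisodicMDP S A H) (q : Fin H → S → A → ℝ) (π : Policy S A H)
    (w : Reward S A H) : ℝ :=
  ∑ h, ∑ s, ∑ a, w (h, s, a) * (M.occ π h s a - q h s a)

/-- `π` is optimal for the reward function `w` up to an error of `εopt`. -/
def IsApproxOpt (M : EpisodicMDP S A H) (εopt : ℝ) (w : Reward S A H) (π : Policy S A H) : Prop :=
  ∀ π' : Policy S A H,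
    M.valueOf (fun h s a => w (h, s, a)) π' ≤ M.valueOf (fun h s a => w (h, s, a)) π + εopt

/-- The mean `(1 / T) ∑_{t = 1}^T P_h^{π^{(t)}}(s, a)` of the state-action distributions. -/
noncomputable def meanOcc (M : EpisodicMDP S A H) (T : ℕ) (π : ℕ → Policy S A H) (h : Fin H)
    (s : S) (a : A) : ℝ :=
  (∑ t ∈ Finset.Icc 1 T, M.occ (π t) h s a) / T

/-- `πbar` is an output of TAIL run on the dataset `D` split into `I` and `Iᶜ`, with `T`
iterations, step sizes `η`, initialization `w₁`, and optimization error `εopt`. Any choice of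
`εopt`-optimal policies in the iterations is allowed, and `πbar` is arbitrary in the states that
have mass zero under the mean state-action distribution. -/
def IsOutput (M : EpisodicMDP S A H) (πE : Fin H → S → A) {m : ℕ} (D : Fin m → Traj S A H)
    (I : Finset (Fin m)) (T : ℕ) (η : ℕ → ℝ) (w₁ : Reward S A H) (εopt : ℝ)
    (πbar : Policy S A H) : Prop :=
  ∃ (w : ℕ → Reward S A H) (π : ℕ → Policy S A H),
    w 1 = w₁ ∧
    (∀ t ∈ Finset.Icc 1 T,
      IsApproxOpt M εopt (w t) (π t) ∧
      IsProj (rewardBall S A H)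
        (w t - η t • ∇ (objective M (estimator M πE D I) (π t)) (w t)) (w (t + 1))) ∧
    ∀ h s, 0 < ∑ a, meanOcc M T π h s a →
      ∀ a, πbar h s a = meanOcc M T π h s a / ∑ a', meanOcc M T π h s a'

end TAIL

/-! Let Δ be the ℓ¹ distance, summed over time steps, between the expert's occupancy measure and the
estimator. TAIL plays a zero-sum game with bilinear payoff. Near-optimality of `π t` for `w t`,
compared with the expert, keeps each payoff f^(t)(w t) above -(εopt + Δ). The regret of projected
gradient descent against the true reward `r` carries this bound over to the average of f^(t)(r).
That average is V^πbar - V^E up to Δ, since normalizing the mean occupancy measure gives a policy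
realizing it (`occ_eq_meanOcc`). Hence the gap is at most average regret + εopt + 2Δ
(`value_sub_value_le_of_isOutput`).

It remains to bound Δ. The covered trajectories cancel exactly, so the error at (h, s) is p - N/n:
the probability of an uncovered trajectory against its frequency in the second half. Conditionally
on the first half, Bernstein in the linear form |p - N/n| ≤ λp + L/(nλ) applies, with the same λ for
all states. An uncovered trajectory meets a state missed at its time step, and with high probability
each missed state has visit probability at most L/|I|. So the p at one time step sum to at most
H|S|L/|I|. With n and |I| of order m, Δ is of order H|S|(L/m)(λH + 1/λ), and λ = 1/√H gives
|S|H^{3/2}L/m. A union bound over 3|S|H events fixes L = log(3|S|H/δ). -/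

namespace EpisodicMDP

/-! ### Marginals of the trajectory law and the flow equations of occupancy measures -/

variable {S A : Type*} [Fintype S] [Fintype A] {H : ℕ}

/-- The law of the state following the truncated trajectory `τ`. -/
noncomputable def nextState (M : EpisodicMDP S A H) {n : ℕ} (hn : n ≤ H) (τ : Traj S A n) :
    stdSimplex ℝ S :=
  if h : 0 < n then
    M.P ⟨n - 1, by omega⟩ (τ ⟨n - 1, by omega⟩).1 (τ ⟨n - 1, by omega⟩).2
  else M.ρ

lemma trajProb_snoc (M : EpisodicMDP S A H) (π : Policy S A H) {n : ℕ} (hn : n + 1 ≤ H)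
    (τ : Traj S A n) (x : S × A) :
    M.trajProb π hn (Fin.snoc (α := fun _ => S × A) τ x)
      = M.trajProb π (Nat.le_of_succ_le hn) τ
        * (M.nextState (Nat.le_of_succ_le hn) τ x.1 * π ⟨n, hn⟩ x.1 x.2) := by
  have h1 : ∀ l : Fin n, M.stateProb hn (Fin.snoc (α := fun _ => S × A) τ x) l.castSucc
      = M.stateProb (Nat.le_of_succ_le hn) τ l := by
    intro l
    have h2 : (Fin.snoc (α := fun _ => S × A) τ x : Fin (n + 1) → S × A)
        ⟨l.1 - 1, by omega⟩ = τ ⟨l.1 - 1, by omega⟩ :=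
      Fin.snoc_castSucc (α := fun _ => S × A) x τ ⟨l.1 - 1, by omega⟩
    simp only [stateProb, Fin.val_castSucc, h2, Fin.snoc_castSucc]
  have h4 : M.stateProb hn (Fin.snoc (α := fun _ => S × A) τ x) (Fin.last n)
      = M.nextState (Nat.le_of_succ_le hn) τ x.1 := by
    unfold stateProb nextState
    by_cases h : 0 < n
    · have h2 : (Fin.snoc (α := fun _ => S × A) τ x : Fin (n + 1) → S × A)
          ⟨n - 1, by omega⟩ = τ ⟨n - 1, by omega⟩ :=
        Fin.snoc_castSucc (α := fun _ => S × A) x τ ⟨n - 1, by omega⟩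
      simp only [Fin.val_last, h, if_true, dif_pos, h2, Fin.snoc_last]
    · simp only [Fin.val_last, h, if_false, dif_neg, not_false_eq_true, Fin.snoc_last]
  simp only [trajProb]
  rw [Fin.prod_univ_castSucc, h4]
  simp only [h1, Fin.snoc_castSucc, Fin.snoc_last]
  rfl

lemma sum_traj_succ {n : ℕ} (G : Traj S A (n + 1) → ℝ) :
    ∑ τ, G τ = ∑ τ : Traj S A n, ∑ s, ∑ a, G (Fin.snoc (α := fun _ => S × A) τ (s, a)) := by
  rw [← (Fin.snocEquiv (fun _ : Fin (n + 1) => S × A)).sum_comp, Fintype.sum_prod_type,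
      Finset.sum_comm]
  refine Finset.sum_congr rfl fun τ _ => ?_
  rw [Fintype.sum_prod_type]
  rfl

/-- Truncated trajectories have the marginal law. -/
lemma sum_trajProb_mul_trunc (M : EpisodicMDP S A H) (π : Policy S A H) {n k : ℕ} (hnk : n ≤ k)
    (hk : k ≤ H) (F : Traj S A n → ℝ) :
    ∑ τ : Traj S A k, M.trajProb π hk τ * F (τ.trunc hnk)
      = ∑ σ : Traj S A n, M.trajProb π (hnk.trans hk) σ * F σ := by
  induction k, hnk using Nat.le_induction with
  | base => rfl
  | succ k hnk ih =>
    rw [sum_traj_succ, ← ih (Nat.le_of_succ_le hk)]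
    refine Finset.sum_congr rfl fun τ _ => ?_
    have h1 : ∀ x, Traj.trunc (Nat.le_succ_of_le hnk) (Fin.snoc (α := fun _ => S × A) τ x)
        = τ.trunc hnk := by
      intro x
      funext l
      exact Fin.snoc_castSucc (α := fun _ => S × A) x τ (Fin.castLE hnk l)
    simp only [trajProb_snoc, h1]
    have h2 : ∀ s a, M.trajProb π (Nat.le_of_succ_le hk) τ
          * (M.nextState (Nat.le_of_succ_le hk) τ s * π ⟨k, hk⟩ s a) * F (τ.trunc hnk)
        = (M.trajProb π (Nat.le_of_succ_le hk) τ * F (τ.trunc hnk))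
          * (M.nextState (Nat.le_of_succ_le hk) τ s * π ⟨k, hk⟩ s a) := by intros; ring
    simp only [h2, ← Finset.mul_sum, stdSimplex.sum_eq_one, mul_one]

/-- The probability of the state `s` at time step `h`. -/
noncomputable def stateOcc (M : EpisodicMDP S A H) (π : Policy S A H) (h : Fin H) (s : S) : ℝ :=
  ∑ σ : Traj S A h.1, M.trajProb π h.2.le σ * M.nextState h.2.le σ s

open scoped Classical in
lemma occ_eq_sum_trunc (M : EpisodicMDP S A H) (π : Policy S A H) (h : Fin H) (s : S) (a : A) :
    M.occ π h s a = ∑ σ : Traj S A (h.1 + 1),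
      if σ (Fin.last h.1) = (s, a) then M.trajProb π h.2 σ else 0 := by
  have h1 := M.sum_trajProb_mul_trunc π (k := H) h.2 le_rfl
    (fun σ : Traj S A (h.1 + 1) => if σ (Fin.last h.1) = (s, a) then (1 : ℝ) else 0)
  simp only [mul_ite, mul_one, mul_zero] at h1
  exact h1

lemma occ_eq_stateOcc_mul (M : EpisodicMDP S A H) (π : Policy S A H) (h : Fin H) (s : S) (a : A) :
    M.occ π h s a = M.stateOcc π h s * π h s a := by
  classical
  rw [occ_eq_sum_trunc, sum_traj_succ, stateOcc, Finset.sum_mul]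
  refine Finset.sum_congr rfl fun τ _ => ?_
  simp only [Fin.snoc_last, trajProb_snoc, Prod.mk.injEq]
  rw [Finset.sum_eq_single s (by intro b _ hb; simp [hb]) (by simp),
    Finset.sum_eq_single a (by intro b _ hb; simp [hb]) (by simp)]
  simp [mul_assoc]

lemma sum_occ_action (M : EpisodicMDP S A H) (π : Policy S A H) (h : Fin H) (s : S) :
    ∑ a, M.occ π h s a = M.stateOcc π h s := by
  simp only [occ_eq_stateOcc_mul, ← Finset.mul_sum, stdSimplex.sum_eq_one, mul_one]

lemma sum_occ_mul (M : EpisodicMDP S A H) (π : Policy S A H) (h : Fin H) (g : S → A → ℝ) :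
    ∑ s, ∑ a, M.occ π h s a * g s a
      = ∑ τ : Traj S A H, M.trajProb π le_rfl τ * g (τ h).1 (τ h).2 := by
  classical
  simp only [occ, Finset.sum_mul]
  rw [← Fintype.sum_prod_type', Finset.sum_comm]
  refine Finset.sum_congr rfl fun τ _ => ?_
  rw [Finset.sum_eq_single (τ h)]
  · simp
  · intro b _ hb
    rw [if_neg (fun h' => hb (by rw [h'])), zero_mul]
  · simp

lemma sum_occ (M : EpisodicMDP S A H) (π : Policy S A H) (h : Fin H) :
    ∑ s, ∑ a, M.occ π h s a = 1 := by
  simpa [M.sum_trajProb] using M.sum_occ_mul π h (fun _ _ => 1)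

lemma occ_nonneg (M : EpisodicMDP S A H) (π : Policy S A H) (h : Fin H) (s : S) (a : A) :
    0 ≤ M.occ π h s a :=
  Finset.sum_nonneg fun τ _ => by split <;> simp [trajProb_nonneg]

lemma stateOcc_zero (M : EpisodicMDP S A H) (π : Policy S A H) (h : Fin H) (h0 : h.1 = 0) (s : S) :
    M.stateOcc π h s = M.ρ s := by
  obtain ⟨h, hh⟩ := h
  subst h0
  simp [stateOcc, nextState, trajProb]

/-- The flow equation: it is linear in the occupancy measure and does not otherwise involve the
policy, so it survives averaging over policies. -/
lemma stateOcc_succ (M : EpisodicMDP S A H) (π : Policy S A H) (k : ℕ) (hk : k + 1 < H) (s : S) :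
    M.stateOcc π ⟨k + 1, hk⟩ s
      = ∑ s', ∑ a', M.occ π ⟨k, by omega⟩ s' a' * M.P ⟨k, by omega⟩ s' a' s := by
  rw [sum_occ_mul M π ⟨k, by omega⟩ (fun s' a' => M.P ⟨k, by omega⟩ s' a' s)]
  exact (M.sum_trajProb_mul_trunc π (k := H) hk.le le_rfl
    (fun σ : Traj S A (k + 1) => M.nextState hk.le σ s)).symm

lemma valueOf_eq_sum_occ (M : EpisodicMDP S A H) (w : Fin H → S → A → ℝ) (π : Policy S A H) :
    M.valueOf w π = ∑ h, ∑ s, ∑ a, w h s a * M.occ π h s a := by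
  simp only [valueOf, Finset.mul_sum]
  rw [Finset.sum_comm]
  refine Finset.sum_congr rfl fun h _ => ?_
  rw [← sum_occ_mul]
  simp only [mul_comm]

end EpisodicMDP

/-! ### Realizing an average of occupancy measures by one policy -/

namespace TAIL

open EpisodicMDP

variable {S A : Type*} [Fintype S] [Fintype A] {H : ℕ}

lemma meanOcc_nonneg (M : EpisodicMDP S A H) (T : ℕ) (π : ℕ → Policy S A H) (h : Fin H)
    (s : S) (a : A) : 0 ≤ meanOcc M T π h s a :=
  div_nonneg (Finset.sum_nonneg fun _ _ => M.occ_nonneg _ _ _ _) (Nat.cast_nonneg _)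

lemma sum_meanOcc_action (M : EpisodicMDP S A H) (T : ℕ) (π : ℕ → Policy S A H) (h : Fin H)
    (s : S) : ∑ a, meanOcc M T π h s a = (∑ t ∈ Finset.Icc 1 T, M.stateOcc (π t) h s) / T := by
  simp only [meanOcc, ← Finset.sum_div]
  rw [Finset.sum_comm]
  simp only [sum_occ_action]

/-- The policy obtained by normalizing the mean state-action distribution realizes it. -/
lemma occ_eq_meanOcc (M : EpisodicMDP S A H) {T : ℕ} (hT : 0 < T) (π : ℕ → Policy S A H)
    (πbar : Policy S A H)
    (hbar : ∀ h s, 0 < ∑ a, meanOcc M T π h s a →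
      ∀ a, πbar h s a = meanOcc M T π h s a / ∑ a', meanOcc M T π h s a') (h : Fin H) (s : S)
    (a : A) : M.occ πbar h s a = meanOcc M T π h s a := by
  have hT' : (T : ℝ) ≠ 0 := by positivity
  have step : ∀ h s a, M.stateOcc πbar h s = ∑ a, meanOcc M T π h s a →
      M.occ πbar h s a = meanOcc M T π h s a := by
    intro h s a hd
    rw [occ_eq_stateOcc_mul, hd]
    rcases (Finset.sum_nonneg fun a (_ : a ∈ Finset.univ) =>
      meanOcc_nonneg M T π h s a).eq_or_lt with h0 | hpos
    -- Where the normalizer vanishes, both sides are zero, so the arbitrary choice of `πbar` there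
    -- is harmless.
    · rw [← h0, zero_mul]
      exact ((Finset.sum_eq_zero_iff_of_nonneg fun a _ => meanOcc_nonneg M T π h s a).1 h0.symm a
        (Finset.mem_univ a)).symm
    · rw [hbar h s hpos a, mul_div_cancel₀ _ hpos.ne']
  -- Both sides start from `ρ` and satisfy the same linear flow equation, so they agree by induction
  -- on time.
  have main : ∀ (k : ℕ) (hk : k < H) s, M.stateOcc πbar ⟨k, hk⟩ s
      = ∑ a, meanOcc M T π ⟨k, hk⟩ s a := by
    intro k
    induction k with
    | zero =>
      intro hk s
      rw [sum_meanOcc_action]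
      simp only [stateOcc_zero]
      simp [hT']
    | succ k ih =>
      intro hk s
      rw [sum_meanOcc_action]
      simp only [stateOcc_succ]
      have h1 : ∀ s' a', M.occ πbar ⟨k, by omega⟩ s' a' = meanOcc M T π ⟨k, by omega⟩ s' a' :=
        fun s' a' => step _ s' a' (ih _ s')
      simp only [h1, meanOcc, div_mul_eq_mul_div, ← Finset.sum_div, Finset.sum_mul]
      congr 1
      rw [Finset.sum_comm (s := Finset.Icc 1 T)]
      refine Finset.sum_congr rfl fun s' _ => ?_
      rw [Finset.sum_comm]
  exact step h s a (main h.1 h.2 s)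

end TAIL

/-! ### Projected online gradient descent and its constants -/

namespace TAIL

/-- The vectors from the projection to `x` and to any point of a convex set form an angle of at
least π/2, so projecting cannot increase the distance to `y`. -/
lemma IsProj.norm_sub_le {E : Type*} [NormedAddCommGroup E] [InnerProductSpace ℝ E] {K : Set E}
    (hK : Convex ℝ K) {x z : E} (hz : IsProj K x z) {y : E} (hy : y ∈ K) :
    ‖z - y‖ ^ 2 ≤ ‖x - y‖ ^ 2 := by
  have hinf : ‖x - z‖ = ⨅ w : K, ‖x - w‖ := by
    have : Nonempty K := ⟨⟨z, hz.1⟩⟩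
    refine le_antisymm (le_ciInf fun w => ?_) ?_
    · rw [norm_sub_rev, norm_sub_rev x]
      exact hz.2 w w.2
    · exact ciInf_le ⟨0, by rintro _ ⟨w, rfl⟩; exact norm_nonneg _⟩ (⟨z, hz.1⟩ : K)
  have h := (norm_eq_iInf_iff_real_inner_le_zero hK hz.1).1 hinf y hy
  have h1 : x - y = (x - z) - (y - z) := by abel
  rw [h1, norm_sub_sq_real (x - z), norm_sub_rev z y]
  nlinarith [sq_nonneg ‖x - z‖]

/-- Regret of projected online gradient descent on linear losses. -/
lemma sum_inner_le_of_projected_descent {E : Type*} [NormedAddCommGroup E]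
    [InnerProductSpace ℝ E] {K : Set E} (hK : Convex ℝ K) (T : ℕ) (w g : ℕ → E) (η G : ℝ)
    (hstep : ∀ t ∈ Finset.Icc 1 T, IsProj K (w t - η • g t) (w (t + 1)))
    (hg : ∀ t ∈ Finset.Icc 1 T, ‖g t‖ ^ 2 ≤ G) {y : E} (hy : y ∈ K) :
    2 * η * ∑ t ∈ Finset.Icc 1 T, inner ℝ (g t) (w t - y)
      ≤ ‖w 1 - y‖ ^ 2 + T * (η ^ 2 * G) := by
  -- Keeping the final distance on the left makes the bound telescope.
  suffices h : 2 * η * ∑ t ∈ Finset.Icc 1 T, inner ℝ (g t) (w t - y) + ‖w (T + 1) - y‖ ^ 2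
      ≤ ‖w 1 - y‖ ^ 2 + T * (η ^ 2 * G) by
    nlinarith [sq_nonneg ‖w (T + 1) - y‖]
  induction T with
  | zero => simp
  | succ T ih =>
    have hsub : ∀ t ∈ Finset.Icc 1 T, t ∈ Finset.Icc 1 (T + 1) := fun t ht => by
      simp only [Finset.mem_Icc] at ht ⊢; omega
    have ih' := ih (fun t ht => hstep t (hsub t ht)) fun t ht => hg t (hsub t ht)
    have hmem : T + 1 ∈ Finset.Icc 1 (T + 1) := by simp
    have h1 := (hstep _ hmem).norm_sub_le hK hy
    have h2 : w (T + 1) - η • g (T + 1) - y = (w (T + 1) - y) - η • g (T + 1) := by abel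
    rw [h2, norm_sub_sq_real (w (T + 1) - y), norm_smul, inner_smul_right, mul_pow,
      Real.norm_eq_abs, sq_abs, real_inner_comm] at h1
    have h3 := mul_le_mul_of_nonneg_left (hg _ hmem) (sq_nonneg η)
    rw [Finset.sum_Icc_succ_top (by omega), mul_add]
    push_cast
    linarith

lemma convex_rewardBall (S A : Type*) (H : ℕ) : Convex ℝ (rewardBall S A H) := by
  intro x hx y hy a b ha hb hab i
  simp only [PiLp.add_apply, PiLp.smul_apply, smul_eq_mul]
  have h1 := abs_le.1 (hx i)
  have h2 := abs_le.1 (hy i)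
  rw [abs_le]
  constructor <;> nlinarith

variable {S A : Type*} [Fintype S] [Fintype A] {H : ℕ}

lemma norm_sub_sq_le_of_mem_rewardBall {w v : Reward S A H} (hw : w ∈ rewardBall S A H)
    (hv : v ∈ rewardBall S A H) :
    ‖w - v‖ ^ 2 ≤ 4 * (H * (Fintype.card S * Fintype.card A)) := by
  rw [EuclideanSpace.real_norm_sq_eq]
  have h : ∀ i, (w - v) i ^ 2 ≤ 4 := fun i => by
    have h1 := abs_le.1 (hw i)
    have h2 := abs_le.1 (hv i)
    rw [PiLp.sub_apply]
    nlinarith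
  refine (Finset.sum_le_sum fun i _ => h i).trans_eq ?_
  simp
  ring

/-- The gradient of the objective. -/
noncomputable def objectiveGrad (M : EpisodicMDP S A H) (q : Fin H → S → A → ℝ)
    (π : Policy S A H) : Reward S A H :=
  WithLp.toLp 2 fun x => M.occ π x.1 x.2.1 x.2.2 - q x.1 x.2.1 x.2.2

lemma objective_eq_inner (M : EpisodicMDP S A H) (q : Fin H → S → A → ℝ) (π : Policy S A H)
    (w : Reward S A H) : objective M q π w = inner ℝ (objectiveGrad M q π) w := by
  simp only [objective, objectiveGrad, PiLp.inner_apply, Fintype.sum_prod_type]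
  rfl

lemma gradient_objective (M : EpisodicMDP S A H) (q : Fin H → S → A → ℝ) (π : Policy S A H)
    (w : Reward S A H) : ∇ (objective M q π) w = objectiveGrad M q π := by
  refine HasGradientAt.gradient ?_
  rw [hasGradientAt_iff_hasFDerivAt]
  have h : objective M q π = fun w => (InnerProductSpace.toDual ℝ _ (objectiveGrad M q π)) w := by
    funext w
    rw [objective_eq_inner, InnerProductSpace.toDual_apply_apply]
  rw [h]
  exact ContinuousLinearMap.hasFDerivAt _

/-- Total masses 1 and at most 2 per time step bound the gradient independently of the numbers of
states and actions: x² ≤ x for x ≤ 1 and y² ≤ 2y for y ≤ 2 give 1 + 2·2 = 5. -/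
lemma norm_objectiveGrad_sq_le (M : EpisodicMDP S A H) {q : Fin H → S → A → ℝ}
    (π : Policy S A H) (hq0 : ∀ h s a, 0 ≤ q h s a) (hq : ∀ h, ∑ s, ∑ a, q h s a ≤ 2) :
    ‖objectiveGrad M q π‖ ^ 2 ≤ 5 * H := by
  rw [EuclideanSpace.real_norm_sq_eq]
  simp only [objectiveGrad, Fintype.sum_prod_type]
  have single : ∀ (f : S → A → ℝ), (∀ s a, 0 ≤ f s a) → ∀ s a, f s a ≤ ∑ s, ∑ a, f s a :=
    fun f hf s a => (Finset.single_le_sum (fun a _ => hf s a) (Finset.mem_univ a)).trans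
      (Finset.single_le_sum (f := fun s => ∑ a, f s a)
        (fun s _ => Finset.sum_nonneg fun a _ => hf s a) (Finset.mem_univ s))
  have h : ∀ h, ∑ s, ∑ a, (M.occ π h s a - q h s a) ^ 2 ≤ 5 := fun h => by
    have h1 : ∀ s a, (M.occ π h s a - q h s a) ^ 2 ≤ M.occ π h s a + 2 * q h s a := by
      intro s a
      have h2 := single _ (fun s a => M.occ_nonneg π h s a) s a
      have h3 := (single _ (hq0 h) s a).trans (hq h)
      rw [M.sum_occ] at h2
      nlinarith [M.occ_nonneg π h s a, hq0 h s a, mul_nonneg (M.occ_nonneg π h s a) (hq0 h s a)]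
    calc _ ≤ ∑ s, ∑ a, (M.occ π h s a + 2 * q h s a) :=
          Finset.sum_le_sum fun s _ => Finset.sum_le_sum fun a _ => h1 s a
      _ = 1 + 2 * ∑ s, ∑ a, q h s a := by
          simp only [Finset.sum_add_distrib, ← Finset.mul_sum, M.sum_occ]
      _ ≤ 5 := by linarith [hq h]
  refine (Finset.sum_le_sum fun i _ => h i).trans_eq ?_
  simp
  ring

open scoped Classical in
lemma estimator_nonneg (M : EpisodicMDP S A H) (πE : Fin H → S → A) {m : ℕ}
    (D : Fin m → Traj S A H) (I : Finset (Fin m)) (h : Fin H) (s : S) (a : A) :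
    0 ≤ estimator M πE D I h s a := by
  unfold estimator
  refine add_nonneg (Finset.sum_nonneg fun τ _ => ?_)
    (div_nonneg (Finset.sum_nonneg fun τ _ => ?_) (Nat.cast_nonneg _))
  · split
    · exact M.trajProb_nonneg _ _ _
    · exact le_rfl
  · split <;> simp

lemma sum_sum_ite_eq_le {x : S × A} {p : Prop} [DecidableEq (S × A)] [Decidable p] {c : ℝ}
    (hc : 0 ≤ c) : ∑ s, ∑ a, (if p ∧ x = (s, a) then c else 0) ≤ c := by
  rw [← Fintype.sum_prod_type' (f := fun s a => if p ∧ x = (s, a) then c else 0)]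
  by_cases hp : p <;> simp [hp, hc]

/-- The exact part and the empirical part each have mass at most 1. They come from different laws,
so the sum need not be a probability. -/
lemma sum_estimator_le (M : EpisodicMDP S A H) (πE : Fin H → S → A) {m : ℕ}
    (D : Fin m → Traj S A H) (I : Finset (Fin m)) (h : Fin H) :
    ∑ s, ∑ a, estimator M πE D I h s a ≤ 2 := by
  classical
  simp only [estimator, Finset.sum_add_distrib]
  have h1 : ∑ s : S, ∑ a : A, ∑ τ : Traj S A (h.1 + 1),
      (if τ ∈ coveredTraj D I h.2 ∧ τ (Fin.last h.1) = (s, a) then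
        M.trajProb (Policy.ofDet πE) h.2 τ else 0) ≤ 1 := by
    rw [← M.sum_trajProb (Policy.ofDet πE) (n := h.1 + 1) h.2,
      ← Fintype.sum_prod_type' (f := fun s a => ∑ τ : Traj S A (h.1 + 1),
      (if τ ∈ coveredTraj D I h.2 ∧ τ (Fin.last h.1) = (s, a) then
        M.trajProb (Policy.ofDet πE) h.2 τ else 0)), Finset.sum_comm]
    refine Finset.sum_le_sum fun τ _ => ?_
    rw [Fintype.sum_prod_type]
    convert sum_sum_ite_eq_le (M.trajProb_nonneg _ _ _)
  have h2 : ∑ s : S, ∑ a : A,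
      (∑ i ∈ Iᶜ, if D i h = (s, a) ∧ (D i).trunc h.2 ∉ coveredTraj D I h.2 then (1 : ℝ) else 0)
      ≤ Iᶜ.card := by
    rw [← Fintype.sum_prod_type' (f := fun s a =>
      (∑ i ∈ Iᶜ, if D i h = (s, a) ∧ (D i).trunc h.2 ∉ coveredTraj D I h.2
        then (1 : ℝ) else 0)), Finset.sum_comm, ← nsmul_one, ← Finset.sum_const]
    refine Finset.sum_le_sum fun i _ => ?_
    rw [Fintype.sum_prod_type]
    simp only [and_comm (a := D i h = _)]
    convert sum_sum_ite_eq_le zero_le_one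
  simp only [← Finset.sum_div]
  have h3 := div_le_one_of_le₀ h2 (Nat.cast_nonneg _)
  linarith

end TAIL

/-! ### From regret and estimation error to sub-optimality -/

namespace TAIL

open EpisodicMDP

variable {S A : Type*} [Fintype S] [Fintype A] {H : ℕ}

/-- The estimator cancels, so near-optimality for `w` transfers to the game payoff. -/
lemma objective_sub_objective (M : EpisodicMDP S A H) (q : Fin H → S → A → ℝ)
    (π π' : Policy S A H) (w : Reward S A H) :
    objective M q π w - objective M q π' w
      = M.valueOf (fun h s a => w (h, s, a)) π - M.valueOf (fun h s a => w (h, s, a)) π' := by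
  simp only [objective, valueOf_eq_sum_occ, ← Finset.sum_sub_distrib]
  refine Finset.sum_congr rfl fun h _ => Finset.sum_congr rfl fun s _ =>
    Finset.sum_congr rfl fun a _ => ?_
  ring

lemma abs_objective_le (M : EpisodicMDP S A H) (q : Fin H → S → A → ℝ) (π : Policy S A H)
    {w : Reward S A H} (hw : w ∈ rewardBall S A H) :
    |objective M q π w| ≤ ∑ h, ∑ s, ∑ a, |M.occ π h s a - q h s a| := by
  refine (Finset.abs_sum_le_sum_abs _ _).trans (Finset.sum_le_sum fun h _ => ?_)
  refine (Finset.abs_sum_le_sum_abs _ _).trans (Finset.sum_le_sum fun s _ => ?_)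
  refine (Finset.abs_sum_le_sum_abs _ _).trans (Finset.sum_le_sum fun a _ => ?_)
  rw [abs_mul]
  exact mul_le_of_le_one_left (abs_nonneg _) (hw _)

lemma sum_valueOf_eq (M : EpisodicMDP S A H) {T : ℕ} (hT : 0 < T) (π : ℕ → Policy S A H)
    {πbar : Policy S A H} (hbar : ∀ h s a, M.occ πbar h s a = meanOcc M T π h s a)
    (w : Fin H → S → A → ℝ) :
    ∑ t ∈ Finset.Icc 1 T, M.valueOf w (π t) = T * M.valueOf w πbar := by
  have hT' : (T : ℝ) ≠ 0 := by positivity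
  simp only [valueOf_eq_sum_occ, hbar, meanOcc]
  rw [Finset.sum_comm, Finset.mul_sum]
  refine Finset.sum_congr rfl fun h _ => ?_
  rw [Finset.sum_comm, Finset.mul_sum]
  refine Finset.sum_congr rfl fun s _ => ?_
  rw [Finset.sum_comm, Finset.mul_sum]
  refine Finset.sum_congr rfl fun a _ => ?_
  rw [← Finset.mul_sum]
  field_simp

/-- The sub-optimality of an output of TAIL is bounded by the average regret, the optimization
error and the error of the estimator. -/
lemma value_sub_value_le_of_isOutput (M : EpisodicMDP S A H) (πE : Fin H → S → A) {m : ℕ}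
    (D : Fin m → Traj S A H) (I : Finset (Fin m)) {T : ℕ} (hT : 0 < T) {η : ℝ} (hη : 0 < η)
    (hηT : 8 * T * η ^ 2 = Fintype.card S * Fintype.card A) {w₁ : Reward S A H}
    (hw₁ : w₁ ∈ rewardBall S A H) {εopt : ℝ} {πbar : Policy S A H}
    (hout : IsOutput M πE D I T (fun _ => η) w₁ εopt πbar) :
    M.value (Policy.ofDet πE) - M.value πbar ≤ 37 / 2 * H * η + εopt
      + 2 * ∑ h, ∑ s, ∑ a, |M.occ (Policy.ofDet πE) h s a - estimator M πE D I h s a| := by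
  obtain ⟨w, π, hw1, hstep, hbar⟩ := hout
  set q := estimator M πE D I
  set Δ := ∑ h, ∑ s, ∑ a, |M.occ (Policy.ofDet πE) h s a - q h s a|
  let r : Reward S A H := WithLp.toLp 2 fun x => M.r x.1 x.2.1 x.2.2
  have hr : r ∈ rewardBall S A H := fun x => abs_le.2
    ⟨by linarith [M.r_nonneg x.1 x.2.1 x.2.2], M.r_le_one x.1 x.2.1 x.2.2⟩
  have hTpos : (0 : ℝ) < T := by exact_mod_cast hT
  have hw : ∀ t ∈ Finset.Icc 1 T, w t ∈ rewardBall S A H := by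
    intro t ht
    rw [Finset.mem_Icc] at ht
    rcases ht.1.eq_or_lt with h | h
    · rw [← h, hw1]; exact hw₁
    · have := (hstep (t - 1) (Finset.mem_Icc.2 ⟨by omega, by omega⟩)).2.1
      rwa [Nat.sub_add_cancel ht.1] at this
  have hregret := sum_inner_le_of_projected_descent (convex_rewardBall S A H) T w
    (fun t => objectiveGrad M q (π t)) η (5 * H)
    (fun t ht => by simpa only [gradient_objective] using (hstep t ht).2)
    (fun t _ => norm_objectiveGrad_sq_le M (π t) (estimator_nonneg M πE D I)
      (sum_estimator_le M πE D I)) hr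
  simp only [inner_sub_right, ← objective_eq_inner] at hregret
  have hdist := norm_sub_sq_le_of_mem_rewardBall (hw1 ▸ hw₁ : w 1 ∈ rewardBall S A H) hr
  rw [← hηT] at hdist
  -- The squared diameter 4H|S||A| equals 32THη² by the choice of η, and the gradient term is 5THη².
  -- Dividing the sum 37THη² by 2η gives the constant.
  have hreg : ∑ t ∈ Finset.Icc 1 T, (objective M q (π t) (w t) - objective M q (π t) r)
      ≤ 37 / 2 * H * η * T := by
    have h : 2 * η * ∑ t ∈ Finset.Icc 1 T, (objective M q (π t) (w t) - objective M q (π t) r)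
        ≤ 2 * η * (37 / 2 * H * η * T) := by linarith
    exact le_of_mul_le_mul_left h (by positivity)
  -- The expert is a competitor in the optimization for `w t`, and its own payoff is at least -Δ.
  have hopt : ∑ _t ∈ Finset.Icc 1 T, (-(εopt + Δ))
      ≤ ∑ t ∈ Finset.Icc 1 T, objective M q (π t) (w t) := by
    refine Finset.sum_le_sum fun t ht => ?_
    have h1 := (hstep t ht).1 (Policy.ofDet πE)
    have h2 := objective_sub_objective M q (π t) (Policy.ofDet πE) (w t)
    have h3 := abs_le.1 (abs_objective_le M q (Policy.ofDet πE) (hw t ht))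
    linarith [h3.1]
  have hval := sum_valueOf_eq M hT π (occ_eq_meanOcc M hT π πbar hbar) M.r
  have hr' : ∑ t ∈ Finset.Icc 1 T, objective M q (π t) r
      = T * (M.value πbar - M.value (Policy.ofDet πE)
        + objective M q (Policy.ofDet πE) r) := by
    have h1 : ∀ t, objective M q (π t) r = M.valueOf M.r (π t)
        + (objective M q (Policy.ofDet πE) r - M.valueOf M.r (Policy.ofDet πE)) := fun t => by
      have := objective_sub_objective M q (π t) (Policy.ofDet πE) r
      simp only [r] at this ⊢
      linarith
    simp only [h1, Finset.sum_add_distrib, hval, Finset.sum_const, Nat.card_Icc,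
      Nat.add_sub_cancel, nsmul_eq_mul, value]
    ring
  have hEr := (abs_le.1 (abs_objective_le M q (Policy.ofDet πE) hr)).2
  rw [Finset.sum_sub_distrib, hr'] at hreg
  simp only [Finset.sum_const, Nat.card_Icc, Nat.add_sub_cancel, nsmul_eq_mul] at hopt
  have hfin : T * (M.value (Policy.ofDet πE) - M.value πbar)
      ≤ T * (37 / 2 * H * η + εopt + 2 * Δ) := by
    have := mul_le_mul_of_nonneg_left hEr hTpos.le
    linarith
  exact le_of_mul_le_mul_left hfin hTpos

end TAIL

/-! ### Exponential moments over half of a product sample, conditionally on the other half -/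

section Concentration

variable {α ι : Type*} [Fintype α] [Fintype ι] [DecidableEq ι] {q : α → ℝ}

lemma sum_pi_prod {κ : Type*} [Fintype κ] [DecidableEq κ] (f : α → ℝ) :
    ∑ y : κ → α, ∏ i, f (y i) = ∏ _i : κ, ∑ x, f x := by
  rw [Finset.prod_univ_sum, Fintype.piFinset_univ]

/-- If the factors have mean at most one and depend on the sample only through the coordinates in
`I`, then the mean of their product over the other coordinates is at most one. -/
lemma sum_prod_mul_prod_compl_le_one (hq0 : ∀ x, 0 ≤ q x) (hq1 : ∑ x, q x = 1) (I : Finset ι)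
    (g : (ι → α) → α → ℝ) (hg : ∀ D D' : ι → α, (∀ i ∈ I, D i = D' i) → g D = g D')
    (hg0 : ∀ D x, 0 ≤ g D x) (hg1 : ∀ D, ∑ x, q x * g D x ≤ 1) :
    ∑ D : ι → α, (∏ i, q (D i)) * ∏ i ∈ Iᶜ, g D (D i) ≤ 1 := by
  classical
  have hne : Nonempty α := by
    by_contra h
    rw [not_nonempty_iff] at h
    simp at hq1
  let x₀ : α := hne.some
  -- Fubini: with the coordinates in `I` frozen, `g` is a fixed function and the remaining
  -- coordinates are independent. The filler `x₀` only completes the sample and does not affect `g`.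
  let e := Equiv.piEquivPiSubtypeProd (fun i => i ∈ I) (fun _ => α)
  have hin : ∀ x y (i : {i // i ∈ I}), e.symm (x, y) i = x i := fun x y i => by
    simp [e]
  have hout : ∀ x y (i : {i // i ∉ I}), e.symm (x, y) i = y i := fun x y i => by
    simp [e, i.2]
  rw [← e.symm.sum_comp, Fintype.sum_prod_type]
  have key : ∀ x y, (∏ i, q (e.symm (x, y) i)) * ∏ i ∈ Iᶜ, g (e.symm (x, y)) (e.symm (x, y) i)
      = (∏ i, q (x i)) * ∏ i, (q (y i) * g (e.symm (x, fun _ => x₀)) (y i)) := by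
    intro x y
    have h1 : g (e.symm (x, y)) = g (e.symm (x, fun _ => x₀)) :=
      hg _ _ fun i hi => (hin x y ⟨i, hi⟩).trans (hin x _ ⟨i, hi⟩).symm
    have h2 : ∀ f : ι → ℝ, ∏ i ∈ Iᶜ, f i = ∏ i : {i // i ∉ I}, f i :=
      fun f => Finset.prod_subtype Iᶜ (by simp) f
    rw [h1, ← Fintype.prod_subtype_mul_prod_subtype (fun i => i ∈ I), h2,
      Finset.prod_mul_distrib]
    simp only [hin, hout, mul_assoc]
    congr!
  simp only [key, ← Finset.mul_sum]
  calc _ ≤ ∑ x : {i // i ∈ I} → α, ∏ i, q (x i) := by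
        refine Finset.sum_le_sum fun x _ => ?_
        rw [sum_pi_prod (fun t => q t * g (e.symm (x, fun _ => x₀)) t)]
        refine mul_le_of_le_one_right (Finset.prod_nonneg fun i _ => hq0 _) ?_
        exact Finset.prod_le_one
          (fun i _ => Finset.sum_nonneg fun t _ => mul_nonneg (hq0 t) (hg0 _ t)) fun i _ => hg1 _
    _ = 1 := by rw [sum_pi_prod, hq1, Finset.prod_const_one]

/-- Markov's inequality for products as in `sum_prod_mul_prod_compl_le_one`. -/
lemma sum_prod_le_exp_neg_of_prod_compl (hq0 : ∀ x, 0 ≤ q x) (hq1 : ∑ x, q x = 1) (I : Finset ι)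
    (g : (ι → α) → α → ℝ) (hg : ∀ D D' : ι → α, (∀ i ∈ I, D i = D' i) → g D = g D')
    (hg0 : ∀ D x, 0 ≤ g D x) (hg1 : ∀ D, ∑ x, q x * g D x ≤ 1) (L : ℝ) (B : (ι → α) → Prop)
    [DecidablePred B]
    (hB : ∀ D, B D → Real.exp L ≤ ∏ i ∈ Iᶜ, g D (D i)) :
    ∑ D : ι → α, (if B D then ∏ i, q (D i) else 0) ≤ Real.exp (-L) := by
  have h := sum_prod_mul_prod_compl_le_one hq0 hq1 I g hg hg0 hg1
  rw [← mul_le_mul_iff_right₀ (Real.exp_pos L), ← Real.exp_add, add_neg_cancel, Real.exp_zero,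
    Finset.mul_sum]
  refine (Finset.sum_le_sum fun D _ => ?_).trans h
  have hW : 0 ≤ ∏ i, q (D i) := Finset.prod_nonneg fun i _ => hq0 _
  split
  · next hD =>
    rw [mul_comm]
    exact mul_le_mul_of_nonneg_left (hB D hD) hW
  · rw [mul_zero]
    exact mul_nonneg hW (Finset.prod_nonneg fun i _ => hg0 _ _)

-- With p the probability of `U`, the moment generating function 1 + p(eˢ - 1) is at most exp(p(s +
-- s²)), because eˢ - 1 ≤ s + s² for |s| ≤ 1. Subtracting s²p in the exponent makes the mean at most
-- one.
open scoped Classical in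
lemma sum_mul_exp_indicator_le_one (hq0 : ∀ x, 0 ≤ q x) (hq1 : ∑ x, q x = 1) (U : α → Prop)
    {s : ℝ} (hs : |s| ≤ 1) :
    ∑ x, q x * Real.exp (s * ((if U x then 1 else 0) - ∑ y, if U y then q y else 0)
      - s ^ 2 * ∑ y, if U y then q y else 0) ≤ 1 := by
  set p := ∑ y, if U y then q y else 0
  have hp : 0 ≤ p := Finset.sum_nonneg fun y _ => by split <;> simp [hq0]
  have h1 : ∀ x, q x * Real.exp (s * ((if U x then 1 else 0) - p) - s ^ 2 * p)
      = (q x + (if U x then q x else 0) * (Real.exp s - 1)) * Real.exp (-(p * (s + s ^ 2))) := by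
    intro x
    by_cases h : U x
    · simp only [h, if_true]
      rw [show s * (1 - p) - s ^ 2 * p = s + -(p * (s + s ^ 2)) by ring, Real.exp_add]
      ring
    · simp only [h, if_false]
      rw [show s * (0 - p) - s ^ 2 * p = -(p * (s + s ^ 2)) by ring]
      ring
  simp only [h1, ← Finset.sum_mul, Finset.sum_add_distrib, hq1]
  have h2 : Real.exp s - 1 ≤ s + s ^ 2 := by
    have := (abs_le.1 (Real.abs_exp_sub_one_sub_id_le hs)).2
    linarith
  have h3 : 1 + p * (Real.exp s - 1) ≤ Real.exp (p * (s + s ^ 2)) := by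
    have := Real.add_one_le_exp (p * (s + s ^ 2))
    nlinarith [mul_le_mul_of_nonneg_left h2 hp]
  calc _ ≤ Real.exp (p * (s + s ^ 2)) * Real.exp (-(p * (s + s ^ 2))) :=
        mul_le_mul_of_nonneg_right h3 (Real.exp_nonneg _)
    _ = 1 := by rw [← Real.exp_add, add_neg_cancel, Real.exp_zero]

open scoped Classical in
/-- One-sided Bernstein inequality for the coordinates outside `I` and an event that may depend on
the coordinates in `I`. -/
lemma sum_prod_bernstein (hq0 : ∀ x, 0 ≤ q x) (hq1 : ∑ x, q x = 1) (I : Finset ι)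
    (U : (ι → α) → α → Prop) (hU : ∀ D D' : ι → α, (∀ i ∈ I, D i = D' i) → U D = U D')
    {s : ℝ} (hs : |s| ≤ 1) (L : ℝ) :
    ∑ D : ι → α, (if L < s * ((∑ i ∈ Iᶜ, if U D (D i) then (1 : ℝ) else 0)
          - Iᶜ.card * ∑ y, if U D y then q y else 0)
          - Iᶜ.card * (s ^ 2 * ∑ y, if U D y then q y else 0)
        then ∏ i, q (D i) else 0) ≤ Real.exp (-L) := by
  refine sum_prod_le_exp_neg_of_prod_compl hq0 hq1 I
    (fun D x => Real.exp (s * ((if U D x then 1 else 0) - ∑ y, if U D y then q y else 0)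
      - s ^ 2 * ∑ y, if U D y then q y else 0)) (fun D D' h => by simp only [hU D D' h])
    (fun _ _ => Real.exp_nonneg _) (fun D => sum_mul_exp_indicator_le_one hq0 hq1 (U D) hs) L _ ?_
  intro D hD
  rw [← Real.exp_sum, Real.exp_le_exp]
  refine hD.le.trans_eq ?_
  rw [Finset.sum_sub_distrib, ← Finset.mul_sum, Finset.sum_sub_distrib]
  simp only [Finset.sum_const, nsmul_eq_mul]

open scoped Classical in
/-- An event with probability more than `L / |I|` occurs on some coordinate in `I`, except with
probability `exp (-L)`. -/
lemma sum_prod_missing (hq0 : ∀ x, 0 ≤ q x) (hq1 : ∑ x, q x = 1) (I : Finset ι)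
    (U : α → Prop) (L : ℝ) :
    ∑ D : ι → α, (if L < I.card * (∑ y, if U y then q y else 0) ∧ ∀ i ∈ I, ¬ U (D i)
        then ∏ i, q (D i) else 0) ≤ Real.exp (-L) := by
  set p := ∑ y, if U y then q y else 0
  -- The product must run over `I`, hence the complement. The factor eᵖ off `U` and 0 on `U` has
  -- mean (1 - p)eᵖ ≤ 1, and its product is e^{|I|p} when `U` never occurs.
  refine sum_prod_le_exp_neg_of_prod_compl hq0 hq1 Iᶜ
    (fun _ x => if U x then 0 else Real.exp p) (fun _ _ _ => rfl)
    (fun _ x => by split <;> simp [Real.exp_nonneg]) (fun D => ?_) L _ ?_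
  · have h1 : ∀ x, q x * (if U x then 0 else Real.exp p)
        = (q x - if U x then q x else 0) * Real.exp p := by
      intro x; by_cases h : U x <;> simp [h]
    simp only [h1, ← Finset.sum_mul, Finset.sum_sub_distrib, hq1]
    calc (1 - p) * Real.exp p ≤ Real.exp (-p) * Real.exp p :=
          mul_le_mul_of_nonneg_right (by linarith [Real.add_one_le_exp (-p)]) (Real.exp_nonneg _)
      _ = 1 := by rw [← Real.exp_add, neg_add_cancel, Real.exp_zero]
  · rintro D ⟨hL, hD⟩
    rw [compl_compl, Finset.prod_congr rfl fun i hi => if_neg (hD i hi), Finset.prod_const,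
      ← Real.exp_nat_mul]
    exact Real.exp_le_exp.2 hL.le

end Concentration

/-! ### Estimation error as a deviation of uncovered trajectories -/

namespace EpisodicMDP

variable {S A : Type*} [Fintype S] [Fintype A] {H : ℕ}

lemma action_eq_of_trajProb_ofDet_ne_zero (M : EpisodicMDP S A H) (πE : Fin H → S → A)
    {τ : Traj S A H} (hτ : M.trajProb (Policy.ofDet πE) le_rfl τ ≠ 0) (h : Fin H) :
    (τ h).2 = πE h (τ h).1 := by
  classical
  have h1 := right_ne_zero_of_mul (Finset.prod_ne_zero_iff.1 hτ h (Finset.mem_univ h))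
  by_contra hne
  refine h1 ?_
  change (Policy.ofDet πE h (τ h).1) (τ h).2 = 0
  simp [Policy.ofDet, stdSimplex.vertex_coe, hne]

end EpisodicMDP

namespace TAIL

open EpisodicMDP

variable {S A : Type*} {H : ℕ}

/-- Coverage depends only on the first half, which is what permits conditioning on it. -/
lemma coveredTraj_congr {m : ℕ} {D D' : Fin m → Traj S A H} {I : Finset (Fin m)}
    (h : ∀ i ∈ I, D i = D' i) {n : ℕ} (hn : n ≤ H) :
    coveredTraj D I hn = coveredTraj D' I hn := by
  ext τ
  refine forall_congr' fun l => exists_congr fun i => and_congr_right fun hi => ?_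
  rw [h i hi]

/-- The trajectory `τ` is in `(s, a)` at time step `h`, and one of its states up to then has not
been visited at the same time step in the part `I` of the dataset. -/
def IsUncovered {m : ℕ} (I : Finset (Fin m)) (h : Fin H) (s : S) (a : A)
    (D : Fin m → Traj S A H) (τ : Traj S A H) : Prop :=
  τ h = (s, a) ∧ τ.trunc h.2 ∉ coveredTraj D I h.2

lemma isUncovered_congr {m : ℕ} {I : Finset (Fin m)} (h : Fin H) (s : S) (a : A)
    (D D' : Fin m → Traj S A H) (hD : ∀ i ∈ I, D i = D' i) :
    IsUncovered I h s a D = IsUncovered I h s a D' := by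
  unfold IsUncovered
  rw [coveredTraj_congr hD]

variable [Fintype S] [Fintype A]

open scoped Classical in
/-- The probability of an uncovered trajectory through `(s, a)` at time step `h`. -/
noncomputable def uncoveredProb (M : EpisodicMDP S A H) (πE : Fin H → S → A) {m : ℕ}
    (I : Finset (Fin m)) (D : Fin m → Traj S A H) (h : Fin H) (s : S) (a : A) : ℝ :=
  ∑ τ, if IsUncovered I h s a D τ then M.trajProb (Policy.ofDet πE) le_rfl τ else 0

open scoped Classical in
/-- The number of uncovered trajectories through `(s, a)` at time step `h` in the second part of
the dataset. -/
noncomputable def uncoveredCount {m : ℕ} (I : Finset (Fin m)) (D : Fin m → Traj S A H)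
    (h : Fin H) (s : S) (a : A) : ℝ :=
  ∑ i ∈ Iᶜ, if IsUncovered I h s a D (D i) then (1 : ℝ) else 0

open scoped Classical in
/-- The probability that the expert visits `s` at time step `h`. -/
noncomputable def visitProb (M : EpisodicMDP S A H) (πE : Fin H → S → A) (h : Fin H) (s : S) : ℝ :=
  ∑ τ : Traj S A H, if (τ h).1 = s then M.trajProb (Policy.ofDet πE) le_rfl τ else 0

/-- Known dynamics make the covered contribution exact, so only the uncovered trajectories carry
sampling error. -/
lemma occ_sub_estimator (M : EpisodicMDP S A H) (πE : Fin H → S → A) {m : ℕ}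
    (I : Finset (Fin m)) (D : Fin m → Traj S A H) (h : Fin H) (s : S) (a : A) :
    M.occ (Policy.ofDet πE) h s a - estimator M πE D I h s a
      = uncoveredProb M πE I D h s a - uncoveredCount I D h s a / Iᶜ.card := by
  classical
  have h1 : uncoveredProb M πE I D h s a = ∑ σ : Traj S A (h.1 + 1),
      if σ (Fin.last h.1) = (s, a) ∧ σ ∉ coveredTraj D I h.2 then
        M.trajProb (Policy.ofDet πE) h.2 σ else 0 := by
    have := M.sum_trajProb_mul_trunc (Policy.ofDet πE) (k := H) h.2 le_rfl
      (fun σ : Traj S A (h.1 + 1) =>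
        if σ (Fin.last h.1) = (s, a) ∧ σ ∉ coveredTraj D I h.2 then (1 : ℝ) else 0)
    simp only [mul_ite, mul_one, mul_zero] at this
    refine (Finset.sum_congr rfl fun τ _ => ?_).trans this
    by_cases hu : IsUncovered I h s a D τ
    · exact (if_pos hu).trans (if_pos hu).symm
    · exact (if_neg hu).trans (if_neg hu).symm
  have h2 : M.occ (Policy.ofDet πE) h s a = (∑ τ : Traj S A (h.1 + 1),
      if τ ∈ coveredTraj D I h.2 ∧ τ (Fin.last h.1) = (s, a) then
        M.trajProb (Policy.ofDet πE) h.2 τ else 0) + uncoveredProb M πE I D h s a := by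
    rw [h1, occ_eq_sum_trunc, ← Finset.sum_add_distrib]
    refine Finset.sum_congr rfl fun σ _ => ?_
    by_cases hc : σ ∈ coveredTraj D I h.2 <;> by_cases hl : σ (Fin.last h.1) = (s, a) <;>
      simp [hc, hl]
  rw [h2, estimator]
  have h3 : uncoveredCount I D h s a = ∑ i ∈ Iᶜ,
      if D i h = (s, a) ∧ (D i).trunc h.2 ∉ coveredTraj D I h.2 then (1 : ℝ) else 0 := by
    refine Finset.sum_congr rfl fun i _ => ?_
    by_cases hu : IsUncovered I h s a D (D i)
    · exact (if_pos hu).trans (if_pos hu).symm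
    · exact (if_neg hu).trans (if_neg hu).symm
  rw [h3]
  ring

/-- The total mass of the uncovered trajectories at one time step is at most the mass of the
states that have not been visited. -/
lemma sum_uncoveredProb_le (M : EpisodicMDP S A H) (πE : Fin H → S → A) {m : ℕ}
    (I : Finset (Fin m)) (D : Fin m → Traj S A H) {c : ℝ} (hc : 0 ≤ c)
    (hmiss : ∀ h s, (∀ i ∈ I, (D i h).1 ≠ s) → visitProb M πE h s ≤ c) (h : Fin H) :
    ∑ s, uncoveredProb M πE I D h s (πE h s) ≤ H * (Fintype.card S * c) := by
  classical
  have h1 : ∑ s, uncoveredProb M πE I D h s (πE h s)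
      ≤ ∑ l : Fin H, ∑ s, if ∀ i ∈ I, (D i l).1 ≠ s then visitProb M πE l s else 0 := by
    have h2 : ∀ l s, (if ∀ i ∈ I, (D i l).1 ≠ s then visitProb M πE l s else 0)
        = ∑ τ : Traj S A H, if (∀ i ∈ I, (D i l).1 ≠ s) ∧ (τ l).1 = s then
            M.trajProb (Policy.ofDet πE) le_rfl τ else 0 := by
      intro l s
      by_cases hs : ∀ i ∈ I, (D i l).1 ≠ s
      · rw [if_pos hs, visitProb]
        exact Finset.sum_congr rfl fun τ _ => if_congr (and_iff_right hs).symm rfl rfl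
      · simp only [hs, false_and, if_false, Finset.sum_const_zero]
    simp only [h2, uncoveredProb]
    rw [Finset.sum_comm, ← Fintype.sum_prod_type' (f := fun l s => ∑ τ : Traj S A H,
      if (∀ i ∈ I, (D i l).1 ≠ s) ∧ (τ l).1 = s then
        M.trajProb (Policy.ofDet πE) le_rfl τ else 0),
      Finset.sum_comm (s := Finset.univ (α := Fin H × S))]
    refine Finset.sum_le_sum fun τ _ => ?_
    have hq := M.trajProb_nonneg (Policy.ofDet πE) le_rfl τ
    -- Each trajectory counts for one state only on the left. On the right it suffices to find one
    -- time step at which its state was missed.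
    rw [Finset.sum_eq_single (τ h).1 (fun s _ hs => if_neg fun hu => hs (by rw [hu.1]))
      (by simp)]
    have hnn : ∀ x ∈ Finset.univ (α := Fin H × S),
        0 ≤ if (∀ i ∈ I, (D i x.1).1 ≠ x.2) ∧ (τ x.1).1 = x.2 then
          M.trajProb (Policy.ofDet πE) le_rfl τ else 0 := fun x _ => by split <;> simp [hq]
    split
    · next hu =>
      have hu2 := hu.2
      simp only [coveredTraj, Set.mem_ofPred_eq, not_forall, not_exists, not_and] at hu2
      obtain ⟨l, hl⟩ := hu2
      refine le_trans ?_ (Finset.single_le_sum hnn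
        (Finset.mem_univ (Fin.castLE h.2 l, (τ (Fin.castLE h.2 l)).1)))
      rw [if_pos ⟨hl, rfl⟩]
    · exact Finset.sum_nonneg hnn
  refine h1.trans ?_
  calc _ ≤ ∑ _l : Fin H, ∑ _s : S, c := by
        refine Finset.sum_le_sum fun l _ => Finset.sum_le_sum fun s _ => ?_
        split
        · next hs => exact hmiss l s hs
        · exact hc
    _ = H * (Fintype.card S * c) := by simp

/-- The error of the estimator on the event that the frequent states have been visited and that the
empirical frequencies of the uncovered trajectories satisfy Bernstein's inequality. -/
lemma sum_abs_occ_sub_estimator_le (M : EpisodicMDP S A H) (πE : Fin H → S → A) {m : ℕ}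
    (I : Finset (Fin m)) (D : Fin m → Traj S A H)
    (hD : ∏ i, M.trajProb (Policy.ofDet πE) le_rfl (D i) ≠ 0)
    {c : ℝ} (hc : 0 ≤ c)
    (hmiss : ∀ h s, (∀ i ∈ I, (D i h).1 ≠ s) → visitProb M πE h s ≤ c) {lam b : ℝ} (hlam : 0 ≤ lam)
    (hbern : ∀ h s, |uncoveredProb M πE I D h s (πE h s)
        - uncoveredCount I D h s (πE h s) / Iᶜ.card|
      ≤ lam * uncoveredProb M πE I D h s (πE h s) + b) :
    ∑ h, ∑ s, ∑ a, |M.occ (Policy.ofDet πE) h s a - estimator M πE D I h s a|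
      ≤ H * (lam * (H * (Fintype.card S * c)) + Fintype.card S * b) := by
  classical
  have h1 : ∀ h s, ∑ a, |M.occ (Policy.ofDet πE) h s a - estimator M πE D I h s a|
      ≤ lam * uncoveredProb M πE I D h s (πE h s) + b := by
    intro h s
    simp only [occ_sub_estimator]
    rw [Finset.sum_eq_single (πE h s)]
    · exact hbern h s
    · intro a _ ha
      -- The expert is deterministic, so actions other than `πE h s` contribute nothing. Hence no
      -- factor |A| in the sample size.
      have h2 : uncoveredProb M πE I D h s a = 0 := by
        refine Finset.sum_eq_zero fun τ _ => ?_
        split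
        · next hu =>
          by_contra hτ
          have := M.action_eq_of_trajProb_ofDet_ne_zero πE hτ h
          rw [hu.1] at this
          exact ha this
        · rfl
      have h3 : uncoveredCount I D h s a = 0 := by
        refine Finset.sum_eq_zero fun i _ => if_neg fun hu => ?_
        have := M.action_eq_of_trajProb_ofDet_ne_zero πE
          (Finset.prod_ne_zero_iff.1 hD i (Finset.mem_univ i)) h
        rw [hu.1] at this
        exact ha this
      simp [h2, h3]
    · simp
  have h4 : ∀ h, ∑ s, ∑ a, |M.occ (Policy.ofDet πE) h s a - estimator M πE D I h s a|
      ≤ lam * (H * (Fintype.card S * c)) + Fintype.card S * b := by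
    intro h
    refine (Finset.sum_le_sum fun s _ => h1 h s).trans ?_
    rw [Finset.sum_add_distrib, ← Finset.mul_sum]
    have := mul_le_mul_of_nonneg_left (sum_uncoveredProb_le M πE I D hc hmiss h) hlam
    simpa using this
  refine (Finset.sum_le_sum fun h _ => h4 h).trans_eq ?_
  simp
  ring

end TAIL

/-! ### Union bound over states and time steps, and the random split -/

namespace TAIL

open EpisodicMDP

variable {S A : Type*} [Fintype S] [Fintype A] {H : ℕ}

open scoped Classical in
/-- The error of the estimator is small with high probability over the dataset, for each split. -/
lemma sum_dataset_estimator_error_le (M : EpisodicMDP S A H) (πE : Fin H → S → A) {m : ℕ}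
    (I : Finset (Fin m)) (hI : 0 < I.card) (hIc : 0 < Iᶜ.card) {lam : ℝ} (hlam : 0 < lam)
    (hlam1 : lam ≤ 1) {L : ℝ} (hL : 0 ≤ L) :
    ∑ D : Fin m → Traj S A H,
      (if H * (lam * (H * (Fintype.card S * (L / I.card)))
            + Fintype.card S * (L / (Iᶜ.card * lam)))
          < ∑ h, ∑ s, ∑ a, |M.occ (Policy.ofDet πE) h s a - estimator M πE D I h s a|
        then ∏ i, M.trajProb (Policy.ofDet πE) le_rfl (D i) else 0)
      ≤ 3 * (Fintype.card S * H) * Real.exp (-L) := by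
  set q : Traj S A H → ℝ := fun τ => M.trajProb (Policy.ofDet πE) le_rfl τ with hq
  have hq0 : ∀ τ, 0 ≤ q τ := M.trajProb_nonneg _ _
  have hq1 : ∑ τ, q τ = 1 := M.sum_trajProb _ _
  have hI' : (0 : ℝ) < I.card := by exact_mod_cast hI
  have hIc' : (0 : ℝ) < Iᶜ.card := by exact_mod_cast hIc
  -- Three bad events per (h, s): a frequent state is missed (`E₁`), or Bernstein fails from above
  -- or below (`E₂` at ±λ).
  let E₁ : Fin H × S → (Fin m → Traj S A H) → Prop := fun x D =>
    L < I.card * visitProb M πE x.1 x.2 ∧ ∀ i ∈ I, ¬ (D i x.1).1 = x.2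
  let E₂ : ℝ → Fin H × S → (Fin m → Traj S A H) → Prop := fun σ x D =>
    L < σ * (uncoveredCount I D x.1 x.2 (πE x.1 x.2)
        - Iᶜ.card * uncoveredProb M πE I D x.1 x.2 (πE x.1 x.2))
      - Iᶜ.card * (σ ^ 2 * uncoveredProb M πE I D x.1 x.2 (πE x.1 x.2))
  have h₁ : ∀ x, ∑ D, (if E₁ x D then ∏ i, q (D i) else 0) ≤ Real.exp (-L) := fun x => by
    convert sum_prod_missing hq0 hq1 I (fun τ : Traj S A H => (τ x.1).1 = x.2) L
    all_goals rfl
  have h₂ : ∀ σ x, |σ| ≤ 1 → ∑ D, (if E₂ σ x D then ∏ i, q (D i) else 0) ≤ Real.exp (-L) :=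
    fun σ x hσ => by
      convert sum_prod_bernstein hq0 hq1 I (IsUncovered I x.1 x.2 (πE x.1 x.2))
        (isUncovered_congr x.1 x.2 (πE x.1 x.2)) hσ L
      all_goals rfl
  have hnn : ∀ (E : Prop) [Decidable E] (D : Fin m → Traj S A H),
      0 ≤ if E then ∏ i, q (D i) else 0 := fun E _ D => by
      split
      · exact Finset.prod_nonneg fun i _ => hq0 _
      · exact le_rfl
  calc _ ≤ ∑ D : Fin m → Traj S A H, ∑ x, ((if E₁ x D then ∏ i, q (D i) else 0)
          + (if E₂ lam x D then ∏ i, q (D i) else 0)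
          + (if E₂ (-lam) x D then ∏ i, q (D i) else 0)) := by
        refine Finset.sum_le_sum fun D _ => ?_
        have hnn' : ∀ x ∈ Finset.univ, 0 ≤ (if E₁ x D then ∏ i, q (D i) else 0)
            + (if E₂ lam x D then ∏ i, q (D i) else 0)
            + (if E₂ (-lam) x D then ∏ i, q (D i) else 0) := fun x _ =>
          add_nonneg (add_nonneg (hnn _ D) (hnn _ D)) (hnn _ D)
        split
        · next hbad =>
          by_cases hex : ∃ x, E₁ x D ∨ E₂ lam x D ∨ E₂ (-lam) x D
          · obtain ⟨x, hx⟩ := hex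
            refine le_trans ?_ (Finset.single_le_sum hnn' (Finset.mem_univ x))
            have a1 := hnn (E₁ x D) D
            have a2 := hnn (E₂ lam x D) D
            have a3 := hnn (E₂ (-lam) x D) D
            rcases hx with hx | hx | hx
            · rw [if_pos hx] at a1 ⊢; linarith
            · rw [if_pos hx] at a2 ⊢; linarith
            · rw [if_pos hx] at a3 ⊢; linarith
          -- Null datasets may contain actions the expert never takes, but they carry no weight.
          · by_cases hD : ∏ i, q (D i) = 0
            · exact hD.le.trans (Finset.sum_nonneg hnn')
            · push Not at hex
              refine absurd hbad (not_lt.2 (sum_abs_occ_sub_estimator_le M πE I D hD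
                (by positivity) ?_ hlam.le ?_))
              · intro h s hs
                have := (hex (h, s)).1
                rw [le_div_iff₀ hI']
                by_contra hlt
                exact this ⟨by simp only; linarith, hs⟩
              · intro h s
                have b1 := not_lt.1 (hex (h, s)).2.1
                have b2 := not_lt.1 (hex (h, s)).2.2
                simp only at b1 b2
                set p := uncoveredProb M πE I D h s (πE h s)
                set N := uncoveredCount I D h s (πE h s)
                set n : ℝ := (Iᶜ.card : ℝ)
                have hpos : 0 < n * lam := by positivity
                have e1 : lam * p + L / (n * lam) = (L + n * (lam ^ 2 * p)) / (n * lam) := by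
                  field_simp
                  ring
                have e2 : p - N / n = (lam * (n * p - N)) / (n * lam) := by
                  field_simp
                rw [e1, e2, abs_div, abs_of_pos hpos]
                refine div_le_div_of_nonneg_right (abs_le.2 ⟨?_, ?_⟩) hpos.le <;> nlinarith
        · exact Finset.sum_nonneg hnn'
    _ ≤ ∑ _x : Fin H × S, 3 * Real.exp (-L) := by
        rw [Finset.sum_comm]
        refine Finset.sum_le_sum fun x _ => ?_
        rw [Finset.sum_add_distrib, Finset.sum_add_distrib]
        have c1 := h₁ x
        have c2 := h₂ lam x (by rwa [abs_of_pos hlam])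
        have c3 := h₂ (-lam) x (by rwa [abs_neg, abs_of_pos hlam])
        linarith
    _ = 3 * (Fintype.card S * H) * Real.exp (-L) := by
        simp
        ring

lemma dataLaw_apply (M : EpisodicMDP S A H) (π : Policy S A H) {m : ℕ}
    (D : Fin m → Traj S A H) :
    M.dataLaw π m D = ENNReal.ofReal (∏ i, M.trajProb π le_rfl (D i)) := by
  rw [ENNReal.ofReal_prod_of_nonneg fun i _ => M.trajProb_nonneg π le_rfl _]
  rfl

lemma sum_prod_trajProb (M : EpisodicMDP S A H) (π : Policy S A H) (m : ℕ) :
    ∑ D : Fin m → Traj S A H, ∏ i, M.trajProb π le_rfl (D i) = 1 := by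
  rw [sum_pi_prod, M.sum_trajProb, Finset.prod_const_one]

open scoped Classical in
/-- A property that fails with probability at most `δ` over the dataset for every split holds with
probability at least `1 - δ` over the dataset and the split. -/
lemma ofReal_le_toOuterMeasure_dataset_split (M : EpisodicMDP S A H) (π : Policy S A H) {m : ℕ}
    {δ : ℝ} (G : Set ((Fin m → Traj S A H) × Finset (Fin m)))
    (hG : ∀ I : Finset (Fin m), I.card = m / 2 →
      ∑ D : Fin m → Traj S A H,
        (if (D, I) ∈ G then 0 else ∏ i, M.trajProb π le_rfl (D i)) ≤ δ) :
    ENNReal.ofReal (1 - δ) ≤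
      ((M.dataLaw π m).bind fun D => (splitLaw m).map fun I => (D, I)).toOuterMeasure G := by
  have h1 : ((M.dataLaw π m).bind fun D => (splitLaw m).map fun I => (D, I)).toOuterMeasure G
      = ∑ I, splitLaw m I * ∑ D, if (D, I) ∈ G then M.dataLaw π m D else 0 := by
    rw [PMF.toOuterMeasure_bind_apply, tsum_fintype]
    have h : ∀ D : Fin m → Traj S A H,
        ((splitLaw m).map fun I => (D, I)).toOuterMeasure G
          = ∑ I, if (D, I) ∈ G then splitLaw m I else 0 := fun D => by
      rw [PMF.toOuterMeasure_map_apply, PMF.toOuterMeasure_apply, tsum_fintype]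
      simp only [Set.indicator, Set.mem_preimage]
    simp only [h, Finset.mul_sum]
    -- The split is independent of the dataset, so it can be fixed first.
    rw [Finset.sum_comm]
    refine Finset.sum_congr rfl fun I _ => Finset.sum_congr rfl fun D _ => ?_
    by_cases h : (D, I) ∈ G <;> simp [h, mul_comm]
  have h2 : ∑ I, splitLaw m I = 1 := by
    rw [← tsum_fintype (L := .unconditional _)]
    exact (splitLaw m).tsum_coe
  rw [h1]
  calc ENNReal.ofReal (1 - δ) = ∑ I, splitLaw m I * ENNReal.ofReal (1 - δ) := by
        rw [← Finset.sum_mul, h2, one_mul]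
    _ ≤ _ := by
        refine Finset.sum_le_sum fun I _ => ?_
        by_cases hI : I.card = m / 2
        · refine mul_le_mul_right ?_ _
          have hnn : ∀ D : Fin m → Traj S A H, 0 ≤ ∏ i, M.trajProb π le_rfl (D i) :=
            fun D => Finset.prod_nonneg fun i _ => M.trajProb_nonneg _ _ _
          have h3 : ∀ D, (if (D, I) ∈ G then M.dataLaw π m D else 0)
              = ENNReal.ofReal (if (D, I) ∈ G then ∏ i, M.trajProb π le_rfl (D i) else 0) := by
            intro D
            by_cases h : (D, I) ∈ G <;> simp [h, dataLaw_apply]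
          simp only [h3]
          rw [← ENNReal.ofReal_sum_of_nonneg fun D _ => by
            by_cases h : (D, I) ∈ G <;> simp [h, hnn]]
          refine ENNReal.ofReal_le_ofReal ?_
          have h4 := hG I hI
          have h5 : ∑ D : Fin m → Traj S A H,
                (if (D, I) ∈ G then ∏ i, M.trajProb π le_rfl (D i) else 0)
              + ∑ D : Fin m → Traj S A H,
                (if (D, I) ∈ G then 0 else ∏ i, M.trajProb π le_rfl (D i)) = 1 := by
            rw [← Finset.sum_add_distrib, ← sum_prod_trajProb M π m]
            refine Finset.sum_congr rfl fun D _ => ?_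
            by_cases h : (D, I) ∈ G <;> simp [h]
          linarith
        · have h3 : splitLaw m I = 0 := by
            rw [splitLaw, PMF.uniformOfFinset_apply_of_notMem]
            simpa using hI
          simp [h3]

/-! ### Sample-size arithmetic -/

/-- The sample size makes the bound on the error of the estimator small. -/
lemma estimator_error_bound_le {s h ε δ m n₁ n₂ : ℝ} (hs : 1 ≤ s) (hh : 5 ≤ h) (hε : 0 < ε)
    (hδ : 0 < δ) (hδ1 : δ < 1) (hm : 96 * (s * h ^ (3 / 2 : ℝ) / ε * Real.log (s * h / δ)) ≤ m)
    (hmpos : 0 < m) (hn₁ : m / 3 ≤ n₁) (hn₂ : m / 3 ≤ n₂) :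
    h * ((√h)⁻¹ * (h * (s * (Real.log (3 * (s * h) / δ) / n₁)))
      + s * (Real.log (3 * (s * h) / δ) / (n₂ * (√h)⁻¹))) ≤ ε / 8 := by
  set R := √h with hR
  have hRpos : 0 < R := Real.sqrt_pos.2 (by linarith)
  have hRsq : h = R ^ 2 := (Real.sq_sqrt (by linarith)).symm
  have hpow : h ^ (3 / 2 : ℝ) = R ^ 3 := by
    rw [hR, Real.sqrt_eq_rpow, ← Real.rpow_natCast, ← Real.rpow_mul (by linarith)]
    norm_num
  have hx : 3 ≤ s * h / δ := by
    rw [le_div_iff₀ hδ]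
    nlinarith
  set l := Real.log (s * h / δ)
  set L := Real.log (3 * (s * h) / δ) with hLdef
  -- The factor 3 from the union bound is absorbed because |S|H/δ ≥ 3.
  have hL : L ≤ 2 * l := by
    have h1 : L = Real.log 3 + l := by
      rw [hLdef, mul_div_assoc, Real.log_mul (by norm_num) (by linarith)]
    have h2 : Real.log 3 ≤ l := Real.log_le_log (by norm_num) hx
    linarith
  have hL0 : 0 ≤ L := Real.log_nonneg (by rw [mul_div_assoc]; linarith)
  have hn₁pos : 0 < n₁ := by linarith
  have hn₂pos : 0 < n₂ := by linarith
  have hinv : ∀ n, m / 3 ≤ n → L / n ≤ 3 * L / m := fun n hn => by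
    rw [div_le_div_iff₀ (by linarith) hmpos]
    nlinarith
  have e : h * (R⁻¹ * (h * (s * (L / n₁))) + s * (L / (n₂ * R⁻¹)))
      = s * R ^ 3 * (L / n₁ + L / n₂) := by
    rw [hRsq]
    field_simp
  rw [hpow] at hm
  have hsR : 0 ≤ s * R ^ 3 := by positivity
  have key : s * R ^ 3 * (L * 96) ≤ 2 * (m * ε) := by
    have h1 : 96 * (s * R ^ 3 * l) ≤ m * ε := by
      have := mul_le_mul_of_nonneg_right hm hε.le
      have h2 : 96 * (s * R ^ 3 / ε * l) * ε = 96 * (s * R ^ 3 * l) := by field_simp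
      linarith
    have := mul_le_mul_of_nonneg_left hL hsR
    linarith
  rw [e]
  calc _ ≤ s * R ^ 3 * (3 * L / m + 3 * L / m) :=
        mul_le_mul_of_nonneg_left (add_le_add (hinv _ hn₁) (hinv _ hn₂)) hsR
    _ = (s * R ^ 3 * (L * 96)) / (16 * m) := by field_simp; ring
    _ ≤ ε / 8 := by
        rw [div_le_div_iff₀ (by positivity) (by norm_num)]
        linarith

/-- The sample size is at least two. -/
lemma two_le_of_sample_size {s h ε δ : ℝ} {m : ℕ} (hs : 1 ≤ s) (hh : 5 ≤ h) (hε : 0 < ε)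
    (hεh : ε < h) (hδ : 0 < δ) (hδ1 : δ < 1)
    (hm : 96 * (s * h ^ (3 / 2 : ℝ) / ε * Real.log (s * h / δ)) ≤ m) : 2 ≤ m := by
  have h1 : h ≤ h ^ (3 / 2 : ℝ) := Real.self_le_rpow_of_one_le (by linarith) (by norm_num)
  have h2 : 1 ≤ s * h ^ (3 / 2 : ℝ) / ε := by
    rw [le_div_iff₀ hε]
    nlinarith
  have h3 : 1 ≤ Real.log (s * h / δ) := by
    rw [Real.le_log_iff_exp_le (by positivity), le_div_iff₀ hδ]
    have := Real.exp_one_lt_d9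
    nlinarith [Real.exp_pos 1]
  have h4 : (2 : ℝ) ≤ m := by nlinarith
  exact_mod_cast h4

end TAIL

/-! ### Choice of constants and conclusion -/

theorem mainTheorem9 :
    ∃ C₁ : ℝ, 0 < C₁ ∧ ∃ C₂ : ℝ, 0 < C₂ ∧
      ∀ (S A : Type*) [Fintype S] [Fintype A] (H : ℕ), 5 ≤ H →
      ∀ (M : EpisodicMDP S A H) (πE : Fin H → S → A) (ε δ : ℝ),
        0 < ε → ε < H → 0 < δ → δ < 1 →
      ∀ (εopt : ℝ), εopt ≤ ε / 2 →
      ∀ (w₁ : TAIL.Reward S A H), w₁ ∈ TAIL.rewardBall S A H →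
      ∀ T : ℕ, C₁ * (Fintype.card S * Fintype.card A * (H : ℝ) ^ 2 / ε ^ 2) ≤ T →
      ∀ m : ℕ, C₂ * (Fintype.card S * (H : ℝ) ^ (3 / 2 : ℝ) / ε
            * Real.log (Fintype.card S * H / δ)) ≤ m →
        ENNReal.ofReal (1 - δ) ≤
          ((M.dataLaw (Policy.ofDet πE) m).bind fun D =>
              (splitLaw m).map fun I => (D, I)).toOuterMeasure
            {x | ∀ πbar : Policy S A H,
              TAIL.IsOutput M πE x.1 x.2 T
                (fun _ => √((Fintype.card S : ℝ) * Fintype.card A / (8 * T))) w₁ εopt πbar →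
              M.value (Policy.ofDet πE) - M.value πbar ≤ ε} := by
  classical
  -- The budget is ε/4 for regret, ε/2 for optimization and 2·ε/8 for estimation. Regret needs 74²/8
  -- = 684.5 ≤ 900. Estimation needs 6L|S|H^{3/2}/m ≤ ε/8, and 96 = 6·2·8 follows from L ≤ 2
  -- log(|S|H/δ).
  refine ⟨900, by norm_num, 96, by norm_num, ?_⟩
  intro S A _ _ H hH M πE ε δ hε hεH hδ hδ1 εopt hopt w₁ hw₁ T hT m hm
  have hSne : Nonempty S := by
    by_contra h
    rw [not_nonempty_iff] at h
    have := stdSimplex.sum_eq_one M.ρ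
    simp at this
  have hAne : Nonempty A := ⟨πE ⟨0, by omega⟩ hSne.some⟩
  have hs : (1 : ℝ) ≤ Fintype.card S := by exact_mod_cast Fintype.card_pos
  have ha : (1 : ℝ) ≤ Fintype.card A := by exact_mod_cast Fintype.card_pos
  have hh : (5 : ℝ) ≤ H := by exact_mod_cast hH
  set s : ℝ := (Fintype.card S : ℝ)
  set a : ℝ := (Fintype.card A : ℝ)
  have hsa : 0 < s * a := by positivity
  have hTr : (0 : ℝ) < T := lt_of_lt_of_le (by positivity) hT
  have hTpos : 0 < T := by exact_mod_cast hTr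
  set η := √(s * a / (8 * T)) with hη
  have hηpos : 0 < η := Real.sqrt_pos.2 (by positivity)
  have hηsq : η ^ 2 = s * a / (8 * T) := Real.sq_sqrt (by positivity)
  have hηT : 8 * T * η ^ 2 = s * a := by
    rw [hηsq]
    field_simp
  have hreg : 37 / 2 * H * η ≤ ε / 4 := by
    have h1 : (74 * H * η) ^ 2 ≤ ε ^ 2 := by
      have h2 : 900 * (s * a * (H : ℝ) ^ 2) ≤ T * ε ^ 2 := by
        rw [← mul_div_assoc, div_le_iff₀ (by positivity)] at hT
        exact hT
      have h3 : (74 * H * η) ^ 2 = 5476 * (s * a * (H : ℝ) ^ 2) / (8 * T) := by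
        rw [mul_pow, hηsq]
        ring
      rw [h3, div_le_iff₀ (by positivity)]
      have : 0 ≤ s * a * (H : ℝ) ^ 2 := by positivity
      linarith
    have := (pow_le_pow_iff_left₀ (by positivity) hε.le two_ne_zero).1 h1
    linarith
  have hm2 := TAIL.two_le_of_sample_size hs hh hε hεH hδ hδ1 hm
  refine TAIL.ofReal_le_toOuterMeasure_dataset_split M _ _ fun I hI => ?_
  have hIc : Iᶜ.card = m - m / 2 := by rw [Finset.card_compl, hI, Fintype.card_fin]
  -- ⌊m/2⌋ ≥ m/3 fails at m = 1, hence the bound 2 ≤ m.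
  have hn₁ : (m : ℝ) / 3 ≤ I.card := by
    have : m ≤ I.card * 3 := by omega
    rw [div_le_iff₀ (by norm_num)]
    exact_mod_cast this
  have hn₂ : (m : ℝ) / 3 ≤ Iᶜ.card := by
    have : m ≤ Iᶜ.card * 3 := by omega
    rw [div_le_iff₀ (by norm_num)]
    exact_mod_cast this
  have hbound := TAIL.estimator_error_bound_le hs hh hε hδ hδ1 hm
    (by exact_mod_cast (by omega : 0 < m)) hn₁ hn₂
  have hsh : 0 < 3 * (s * H) / δ := by positivity
  have hL : 0 ≤ Real.log (3 * (s * H) / δ) := Real.log_nonneg (by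
    rw [le_div_iff₀ hδ]
    nlinarith)
  refine le_trans (Finset.sum_le_sum fun D _ => ?_)
    ((TAIL.sum_dataset_estimator_error_le M πE I (by omega) (by omega)
      (lam := (√(H : ℝ))⁻¹) (by positivity)
      (inv_le_one_of_one_le₀ (Real.one_le_sqrt.2 (by linarith))) hL).trans_eq ?_)
  · have hW : 0 ≤ ∏ i, M.trajProb (Policy.ofDet πE) le_rfl (D i) :=
      Finset.prod_nonneg fun i _ => M.trajProb_nonneg _ _ _
    split
    · split
      · exact hW
      · exact le_rfl
    · next hbad =>
      rw [if_pos]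
      by_contra hgood
      refine hbad fun πbar hout => ?_
      have h1 := TAIL.value_sub_value_le_of_isOutput M πE D I hTpos hηpos hηT hw₁ hout
      have h2 := (not_lt.1 hgood).trans hbound
      linarith
  -- L was chosen so that 3|S|H·exp(-L) = δ.
  · change 3 * (s * H) * _ = δ
    rw [Real.exp_neg, Real.exp_log hsh]
    field_simp
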